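/- For $n\in\{3,7\}$ let $\mathbb S^{2n-1}=\{(p,w)\in\mathbb R^n\times\mathbb R^n : |p|^2+|w|^2=1\}$ and let the Brieskorn sphere $W^{2n-1}_3\subset\mathbb C\oplus\mathbb C^n$ be the set of all $(z_0,z)$ with $$\tfrac89 z_0^3+z_1^2+\dots+z_n^2=0,\qquad \tfrac43|z_0|^2+|z_1|^2+\dots+|z_n|^2=\tfrac49 .$$ Let $p\times w$ denote the standard cross product if $n=3$, and, if $n=7$, the imaginary part of the octonion product $pw$, where $\mathbb R^7$ is identified with the imaginary octonions. Define $\psi(p,w)=(x_0+iy_0,\;x+iy)$ by $$x_0=\tfrac12(|w|^2-|p|^2),\qquad y_0=-\langle p,w\rangle,$$ $$x=\tfrac{1}{3(1+|p|^2)^2}\Bigl(\bigl((3-2|p|^2)(1+|p|^2)^2-4(1-|p|^2)\langle w,p\rangle^2\bigr)p-2\bigl(3+8|p|^2+|p|^4-4\langle w,p\rangle^2\bigr)\langle p,w\rangle\, w-8|p|^2\langle p,w\rangle\, p\times w\Bigr),$$ $$y=\tfrac{1}{3(1+|p|^2)^2}\Bigl(\bigl(-(1+2|p|^2)(1-6|p|^2+|p|^4)-4(1+3|p|^2)\langle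 w,p\rangle^2\bigr)w+2(1-|p|^2)(1+3|p|^2)\langle w,p\rangle\, p-4(1+2|p|^2)(1-|p|^2)\,p\times w\Bigr).$$ Let $G=\mathrm{SO}(3)$ if $n=3$, and let $G=\mathrm G_2$, the automorphism group of the octonions acting on the imaginary octonions $\mathbb R^7$, if $n=7$. Let $G$ act on $\mathbb S^{2n-1}$ by $g\cdot(p,w)=(gp,gw)$ and on $W^{2n-1}_3$ by $g\cdot(z_0,x+iy)=(z_0,gx+igy)$. Then $\psi$ is a $G$-equivariant diffeomorphism of $\mathbb S^{2n-1}$ onto $W^{2n-1}_3$; that is, $\psi$ is an $\mathrm{SO}(3)$-equivariant diffeomorphism $\mathbb S^5\to W^5_3$ for $n=3$ and a $\mathrm G_2$-equivariant diffeomorphism $\mathbb S^{13}\to W^{13}_3$ for $n=7$. -/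

import Mathlib

open scoped ContDiff Quaternion

namespace BrieskornSpheres

/-- Real Euclidean `n`-space. -/
abbrev E (n : ℕ) : Type := EuclideanSpace ℝ (Fin n)

/-! ### Smooth maps and diffeomorphisms between subsets of normed spaces -/

section Smooth

variable {V V' : Type*} [NormedAddCommGroup V] [NormedSpace ℝ V]
  [NormedAddCommGroup V'] [NormedSpace ℝ V']

/-- `f` is smooth on the (arbitrary) subset `A` of a normed space: near every point of `A` it agrees
on `A` with a smooth map that is defined on an open subset of the ambient space. For embedded
submanifolds `A` this is the usual smoothness. -/
def SmoothOnSubset (f : V → V') (A : Set V) : Prop :=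
  ∀ a ∈ A, ∃ (U : Set V) (F : V → V'), IsOpen U ∧ a ∈ U ∧ ContDiffOn ℝ ∞ F U ∧
    Set.EqOn f F (A ∩ U)

/-- `f` restricts to a diffeomorphism from the subset `A` onto the subset `B`: it is a smooth
bijection `A → B` whose inverse `B → A` is smooth. -/
def IsDiffeomorphismOnto (f : V → V') (A : Set V) (B : Set V') : Prop :=
  Set.MapsTo f A B ∧ SmoothOnSubset f A ∧
    ∃ g : V' → V, Set.MapsTo g B A ∧ Set.InvOn g f A B ∧ SmoothOnSubset g B

end Smooth

/-! ### The spheres -/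

/-- The unit sphere `S^{2n-1}` in `ℝⁿ × ℝⁿ`, as the set of pairs `(p, w)` with
`|p|² + |w|² = 1`. -/
def unitSphere (n : ℕ) : Set (E n × E n) :=
  {q | ‖q.1‖ ^ 2 + ‖q.2‖ ^ 2 = 1}

/-- The Brieskorn sphere `W^{2n-1}_3` in `ℂ ⊕ ℂⁿ`. -/
def brieskornSphere (n : ℕ) : Set (ℂ × EuclideanSpace ℂ (Fin n)) :=
  {z | (8 / 9 : ℂ) * z.1 ^ 3 + ∑ i, z.2 i ^ 2 = 0 ∧
    (4 / 3 : ℝ) * ‖z.1‖ ^ 2 + ∑ i, ‖z.2 i‖ ^ 2 = 4 / 9}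

/-- The complex vector `x + i y`. -/
noncomputable def complexVec {n : ℕ} (x y : E n) : EuclideanSpace ℂ (Fin n) :=
  WithLp.toLp 2 fun i => (⟨x i, y i⟩ : ℂ)

/-- The real part of a complex vector. -/
noncomputable def reVec {n : ℕ} (z : EuclideanSpace ℂ (Fin n)) : E n :=
  WithLp.toLp 2 fun i => (z i).re

/-- The imaginary part of a complex vector. -/
noncomputable def imVec {n : ℕ} (z : EuclideanSpace ℂ (Fin n)) : E n :=
  WithLp.toLp 2 fun i => (z i).im

/-! ### The explicit formula, for a given product `cross` on `ℝⁿ` -/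

/-- The component `x` of the formula. -/
noncomputable def formulaX {n : ℕ} (cross : E n → E n → E n) (p w : E n) : E n :=
  (1 / (3 * (1 + ‖p‖ ^ 2) ^ 2)) •
    (((3 - 2 * ‖p‖ ^ 2) * (1 + ‖p‖ ^ 2) ^ 2
        - 4 * (1 - ‖p‖ ^ 2) * (inner ℝ w p) ^ 2) • p
      - (2 * (3 + 8 * ‖p‖ ^ 2 + ‖p‖ ^ 4 - 4 * (inner ℝ w p) ^ 2) * inner ℝ p w) • w
      - (8 * ‖p‖ ^ 2 * inner ℝ p w) • cross p w)

/-- The component `y` of the formula. -/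
noncomputable def formulaY {n : ℕ} (cross : E n → E n → E n) (p w : E n) : E n :=
  (1 / (3 * (1 + ‖p‖ ^ 2) ^ 2)) •
    ((-(1 + 2 * ‖p‖ ^ 2) * (1 - 6 * ‖p‖ ^ 2 + ‖p‖ ^ 4)
        - 4 * (1 + 3 * ‖p‖ ^ 2) * (inner ℝ w p) ^ 2) • w
      + (2 * (1 - ‖p‖ ^ 2) * (1 + 3 * ‖p‖ ^ 2) * inner ℝ w p) • p
      - (4 * (1 + 2 * ‖p‖ ^ 2) * (1 - ‖p‖ ^ 2)) • cross p w)

/-- The map `(p, w) ↦ (x₀ + i y₀, x + i y)` given by the formula. -/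
noncomputable def brieskornMap {n : ℕ} (cross : E n → E n → E n) (q : E n × E n) :
    ℂ × EuclideanSpace ℂ (Fin n) :=
  ((⟨1 / 2 * (‖q.2‖ ^ 2 - ‖q.1‖ ^ 2), -inner ℝ q.1 q.2⟩ : ℂ),
    complexVec (formulaX cross q.1 q.2) (formulaY cross q.1 q.2))

/-! ### Actions and equivariance -/

section Equivariance

variable {G : Type*} [Group G] {n : ℕ}

/-- The diagonal action `g • (p, w) = (g p, g w)` on `ℝⁿ × ℝⁿ`. -/
noncomputable def diagAction (ρ : Representation ℝ G (E n)) (g : G) (q : E n × E n) : E n × E n :=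
  (ρ g q.1, ρ g q.2)

/-- The action `g • (z₀, x + i y) = (z₀, g x + i g y)` on `ℂ ⊕ ℂⁿ`. -/
noncomputable def complexAction (ρ : Representation ℝ G (E n)) (g : G)
    (z : ℂ × EuclideanSpace ℂ (Fin n)) : ℂ × EuclideanSpace ℂ (Fin n) :=
  (z.1, complexVec (ρ g (reVec z.2)) (ρ g (imVec z.2)))

/-- `f` restricts to an equivariant diffeomorphism from `S^{2n-1}` onto `W^{2n-1}_3`. That both
sets are invariant, so that `G` does act on them, is part of the assertion. -/
def IsEquivariantDiffeomorphism (ρ : Representation ℝ G (E n))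
    (f : E n × E n → ℂ × EuclideanSpace ℂ (Fin n)) : Prop :=
  IsDiffeomorphismOnto f (unitSphere n) (brieskornSphere n) ∧
    ∀ g : G, Set.MapsTo (diagAction ρ g) (unitSphere n) (unitSphere n) ∧
      Set.MapsTo (complexAction ρ g) (brieskornSphere n) (brieskornSphere n) ∧
      ∀ q ∈ unitSphere n, f (diagAction ρ g q) = complexAction ρ g (f q)

end Equivariance

/-! ### Dimension three -/

/-- The standard cross product of `ℝ³`. -/
noncomputable def cross3 (p w : E 3) : E 3 :=
  WithLp.toLp 2 (crossProduct p.ofLp w.ofLp)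

/-- The standard representation of `SO(3)` on `ℝ³`. -/
noncomputable def so3Rep : Representation ℝ (Matrix.specialOrthogonalGroup (Fin 3) ℝ) (E 3) where
  toFun A := Matrix.toEuclideanLin (A : Matrix (Fin 3) (Fin 3) ℝ)
  map_one' := by
    ext v i
    simp
  map_mul' A B := by
    ext v i
    simp [Matrix.toLpLin_apply]

/-! ### Octonions, their imaginary part and `G₂` -/

/-- An octonion, as a pair of quaternions. -/
@[ext] structure Octonion where
  /-- The first quaternion. -/
  fst : ℍ[ℝ]
  /-- The second quaternion. -/
  snd : ℍ[ℝ]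

namespace Octonion

/-- Octonions are the pairs of quaternions; the real vector space structure is componentwise. -/
def equivProd : Octonion ≃ ℍ[ℝ] × ℍ[ℝ] where
  toFun u := (u.fst, u.snd)
  invFun u := ⟨u.1, u.2⟩
  left_inv _ := rfl
  right_inv _ := rfl

noncomputable instance : AddCommGroup Octonion := equivProd.addCommGroup

noncomputable instance : Module ℝ Octonion := equivProd.module ℝ

/-- The Cayley–Dickson product `(a, b) (c, d) = (a c - d̄ b, d a + b c̄)`. -/
noncomputable instance : Mul Octonion :=
  ⟨fun u v => ⟨u.fst * v.fst - star v.snd * u.snd, v.snd * u.fst + u.snd * star v.fst⟩⟩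

/-- The unit octonion. -/
noncomputable instance : One Octonion := ⟨⟨1, 0⟩⟩

@[simp] theorem fst_add (u v : Octonion) : (u + v).fst = u.fst + v.fst := rfl
@[simp] theorem snd_add (u v : Octonion) : (u + v).snd = u.snd + v.snd := rfl
@[simp] theorem fst_sub (u v : Octonion) : (u - v).fst = u.fst - v.fst := rfl
@[simp] theorem snd_sub (u v : Octonion) : (u - v).snd = u.snd - v.snd := rfl
@[simp] theorem fst_smul (c : ℝ) (u : Octonion) : (c • u).fst = c • u.fst := rfl
@[simp] theorem snd_smul (c : ℝ) (u : Octonion) : (c • u).snd = c • u.snd := rfl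
@[simp] theorem fst_one : (1 : Octonion).fst = 1 := rfl
@[simp] theorem snd_one : (1 : Octonion).snd = 0 := rfl
@[simp] theorem fst_mul (u v : Octonion) :
    (u * v).fst = u.fst * v.fst - star v.snd * u.snd := rfl
@[simp] theorem snd_mul (u v : Octonion) :
    (u * v).snd = v.snd * u.fst + u.snd * star v.fst := rfl

/-- The identification of `ℝ⁷` with the imaginary octonions, through the standard orthonormal
basis. -/
noncomputable def ofIm : E 7 →ₗ[ℝ] Octonion where
  toFun v := ⟨⟨0, v 0, v 1, v 2⟩, ⟨v 3, v 4, v 5, v 6⟩⟩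
  map_add' v w := by
    apply Octonion.ext <;> apply Quaternion.ext
    · exact (add_zero (0 : ℝ)).symm
    all_goals rfl
  map_smul' c v := by
    apply Octonion.ext <;> apply Quaternion.ext
    · exact (mul_zero c).symm
    all_goals rfl

/-- The imaginary part of an octonion, as a vector of `ℝ⁷`. -/
noncomputable def im : Octonion →ₗ[ℝ] E 7 where
  toFun u := !₂[u.fst.imI, u.fst.imJ, u.fst.imK, u.snd.re, u.snd.imI, u.snd.imJ, u.snd.imK]
  map_add' u v := by
    ext i
    fin_cases i <;> simp
  map_smul' c u := by
    ext i
    fin_cases i <;> simp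

theorem ofIm_apply (v : E 7) : ofIm v = ⟨⟨0, v 0, v 1, v 2⟩, ⟨v 3, v 4, v 5, v 6⟩⟩ := rfl

theorem im_apply (u : Octonion) : im u =
    !₂[u.fst.imI, u.fst.imJ, u.fst.imK, u.snd.re, u.snd.imI, u.snd.imJ, u.snd.imK] := rfl

theorem im_ofIm (v : E 7) : im (ofIm v) = v := by
  ext i
  fin_cases i <;> rfl

theorem ofIm_im {u : Octonion} (hu : u.fst.re = 0) : ofIm (im u) = u := by
  ext <;> simp [ofIm_apply, im_apply, hu]

protected theorem one_mul (u : Octonion) : 1 * u = u := by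
  apply Octonion.ext <;> simp

protected theorem mul_one (u : Octonion) : u * 1 = u := by
  apply Octonion.ext <;> simp

theorem mul_self (u : Octonion) :
    u * u = (2 * u.fst.re) • u -
      (Quaternion.normSq u.fst + Quaternion.normSq u.snd) • (1 : Octonion) := by
  ext <;> simp [Quaternion.normSq_def'] <;> ring

end Octonion

/-- The cross product of `ℝ⁷`: the imaginary part of the product of two imaginary octonions. -/
noncomputable def cross7 (p w : E 7) : E 7 :=
  Octonion.im (Octonion.ofIm p * Octonion.ofIm w)

/-- The group `G₂` of automorphisms of the real algebra of octonions. -/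
def G2 : Subgroup (Octonion ≃ₗ[ℝ] Octonion) where
  carrier := {φ | ∀ u v : Octonion, φ (u * v) = φ u * φ v}
  one_mem' := fun _ _ => rfl
  mul_mem' := by
    intro φ χ hφ hχ u v
    change φ (χ (u * v)) = φ (χ u) * φ (χ v)
    rw [hχ u v, hφ]
  inv_mem' := by
    intro φ hφ u v
    change φ.symm (u * v) = φ.symm u * φ.symm v
    apply φ.injective
    rw [hφ, φ.apply_symm_apply, φ.apply_symm_apply, φ.apply_symm_apply]

theorem G2.map_one (φ : G2) : φ.1 1 = 1 := by
  have h := φ.2 1 (φ.1.symm 1)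
  rw [Octonion.one_mul, LinearEquiv.apply_symm_apply, Octonion.mul_one] at h
  exact h.symm

/-- Automorphisms preserve the imaginary octonions. -/
theorem G2.map_im (φ : G2) {u : Octonion} (hu : u.fst.re = 0) : (φ.1 u).fst.re = 0 := by
  by_contra hr
  have h1 : φ.1 u * φ.1 u = φ.1 (u * u) := (φ.2 u u).symm
  rw [Octonion.mul_self, Octonion.mul_self, hu, mul_zero, zero_smul, zero_sub, map_neg, map_smul,
    G2.map_one, ← neg_smul, sub_eq_iff_eq_add, ← add_smul] at h1
  have h2 : ∃ c : ℝ, φ.1 u = c • (1 : Octonion) :=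
    ⟨(2 * (φ.1 u).fst.re)⁻¹ * _, by rw [mul_smul, ← h1, inv_smul_smul₀ (by simpa using hr)]⟩
  obtain ⟨c, hc⟩ := h2
  have h3 : u = c • (1 : Octonion) := by
    apply φ.1.injective
    rw [hc, map_smul, G2.map_one]
  rw [hc, ← h3] at hr
  exact hr hu

/-- The standard representation of `G₂` on `ℝ⁷`, that is, on the imaginary octonions. -/
noncomputable def g2Rep : Representation ℝ G2 (E 7) where
  toFun φ := Octonion.im ∘ₗ φ.1.toLinearMap ∘ₗ Octonion.ofIm
  map_one' := by
    ext1 v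
    exact Octonion.im_ofIm v
  map_mul' φ χ := by
    ext1 v
    change Octonion.im (φ.1 (χ.1 (Octonion.ofIm v))) =
      Octonion.im (φ.1 (Octonion.ofIm (Octonion.im (χ.1 (Octonion.ofIm v)))))
    rw [Octonion.ofIm_im (G2.map_im χ rfl)]

end BrieskornSpheres

/-! Put `a = |p|²` and `c = ⟨p, w⟩`. On the unit sphere `z₀ = (1/2 - a) - ic`, so `z₀` alone
determines the Gram matrix of `(p, w)`. On the Brieskorn sphere the two defining equations likewise
express the Gram matrix of `(x, y)` through `z₀`.

Both cross products satisfy the axioms `IsVectorProduct`, which make the span of `u, v, u × v`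
closed under the product, with structure constants given by the Gram matrix of `(u, v)`. Hence `x`,
`y`, `x × y` are combinations of `p`, `w`, `p × w` with coefficients rational in `a, c`. The Gram
determinant of `(x, y)` is `(16/81)(1 - |z₀|²)²` times that of `(p, w)`, so this 3×3 transition
matrix is invertible while `|z₀| < 1`. The rows of its inverse for `p` and `w` give `inverseP` and
`inverseW`. That the two maps are mutually inverse is then an identity of rational functions in `a,
c`, checked coefficient by coefficient.

The denominators are `(1 + a)²` and `(1 + a)²(1 - |z₀|²)` up to constants. They do not vanish
because `|z₀| ≤ 1/2` on the Brieskorn sphere (`norm_fst_sq_le`), a form of Cauchy–Schwarz for `x,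
y`; so the inverse is smooth near that sphere. Equivariance needs only that the group preserves
inner and cross products. -/

namespace BrieskornSpheres

/-! ### Vector products and the algebra generated by two vectors -/

/-- The properties shared by the cross products of `ℝ³` and `ℝ⁷`. -/
structure IsVectorProduct {n : ℕ} (cross : E n → E n → E n) : Prop where
  contDiff : ContDiff ℝ ∞ fun q : E n × E n => cross q.1 q.2
  add_left : ∀ x y z, cross (x + y) z = cross x z + cross y z
  smul_left : ∀ (r : ℝ) x y, cross (r • x) y = r • cross x y
  anticomm : ∀ x y, cross x y = -cross y x
  cross_cross : ∀ x y, cross x (cross x y) = inner ℝ x y • x - inner ℝ x x • y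
  inner_left : ∀ x y, inner ℝ x (cross x y) = 0
  inner_self : ∀ x y, inner ℝ (cross x y) (cross x y) =
    inner ℝ x x * inner ℝ y y - inner ℝ x y ^ 2

namespace IsVectorProduct

variable {n : ℕ} {cross : E n → E n → E n} (h : IsVectorProduct cross)
include h

theorem add_right (x y z : E n) : cross x (y + z) = cross x y + cross x z := by
  rw [h.anticomm, h.add_left, neg_add, ← h.anticomm, ← h.anticomm]

theorem smul_right (r : ℝ) (x y : E n) : cross x (r • y) = r • cross x y := by
  rw [h.anticomm, h.smul_left, ← smul_neg, ← h.anticomm]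

theorem self_eq_zero (x : E n) : cross x x = 0 := by
  have h₂ : (2 : ℝ) • cross x x = 0 := by
    rw [two_smul, ← eq_neg_iff_add_eq_zero]
    exact h.anticomm x x
  simpa using h₂

theorem inner_right (x y : E n) : inner ℝ y (cross x y) = 0 := by
  rw [h.anticomm, inner_neg_right, h.inner_left, neg_zero]

theorem cross_cross_right (x y : E n) :
    cross y (cross x y) = inner ℝ y y • x - inner ℝ x y • y := by
  rw [h.anticomm x y, ← neg_one_smul ℝ, h.smul_right, h.cross_cross, real_inner_comm y x]
  module

/-- The product of two elements of the algebra generated by `x` and `y`. -/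
theorem cross_combination (x y : E n) (α β γ δ ε ζ : ℝ) :
    cross (α • x + β • y + γ • cross x y) (δ • x + ε • y + ζ • cross x y) =
      ((β * ζ - γ * ε) * inner ℝ y y - (γ * δ - α * ζ) * inner ℝ x y) • x +
      ((γ * δ - α * ζ) * inner ℝ x x - (β * ζ - γ * ε) * inner ℝ x y) • y +
      (α * ε - β * δ) • cross x y := by
  simp only [h.add_left, h.add_right, h.smul_left, h.smul_right, h.self_eq_zero, h.cross_cross,
    h.cross_cross_right]
  rw [h.anticomm (cross x y) x, h.anticomm (cross x y) y, h.anticomm y x, h.cross_cross,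
    h.cross_cross_right]
  module

/-- The inner product of two elements of the algebra generated by `x` and `y`. -/
theorem inner_combination (x y : E n) (α β γ δ ε ζ : ℝ) :
    inner ℝ (α • x + β • y + γ • cross x y) (δ • x + ε • y + ζ • cross x y) =
      α * δ * inner ℝ x x + (α * ε + β * δ) * inner ℝ x y + β * ε * inner ℝ y y +
      γ * ζ * (inner ℝ x x * inner ℝ y y - inner ℝ x y ^ 2) := by
  simp only [inner_add_left, inner_add_right, inner_smul_left, inner_smul_right, h.inner_left,
    h.inner_right, h.inner_self, real_inner_comm x (cross x y), real_inner_comm y (cross x y),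
    real_inner_comm x y, RCLike.conj_to_real]
  ring

end IsVectorProduct

/-! ### Gram matrices and coefficients of the map and its inverse -/

/-- The value of `|x|²` in terms of `a = |p|²` and `c = ⟨p, w⟩`. -/
noncomputable def normSqX (a c : ℝ) : ℝ :=
  (4 / 9 - 4 / 3 * ((1 / 2 - a) ^ 2 + c ^ 2)
    - 8 / 9 * ((1 / 2 - a) ^ 3 - 3 * (1 / 2 - a) * c ^ 2)) / 2

/-- The value of `|y|²` in terms of `a = |p|²` and `c = ⟨p, w⟩`. -/
noncomputable def normSqY (a c : ℝ) : ℝ :=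
  (4 / 9 - 4 / 3 * ((1 / 2 - a) ^ 2 + c ^ 2)
    + 8 / 9 * ((1 / 2 - a) ^ 3 - 3 * (1 / 2 - a) * c ^ 2)) / 2

/-- The value of `⟨x, y⟩` in terms of `a = |p|²` and `c = ⟨p, w⟩`. -/
noncomputable def innerXY (a c : ℝ) : ℝ :=
  -(4 / 9) * (3 * (1 / 2 - a) ^ 2 * (-c) + c ^ 3)

/-- The component `p` of the inverse of the formula. -/
noncomputable def inverseP {n : ℕ} (cross : E n → E n → E n) (a c : ℝ) (x y : E n) : E n :=
  (4 * (1 + a) ^ 2 * (1 - (1 / 2 - a) ^ 2 - c ^ 2))⁻¹ •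
    ((3 * (1 - 28 * c ^ 2 + 4 * a + 12 * a * c ^ 2 + 5 * a ^ 2 + 2 * a ^ 3)) • x
      + (3 * c * (-6 + 8 * c ^ 2 + 32 * a - 2 * a ^ 2)) • y + (72 * c) • cross x y)

/-- The component `w` of the inverse of the formula. -/
noncomputable def inverseW {n : ℕ} (cross : E n → E n → E n) (a c : ℝ) (x y : E n) : E n :=
  (4 * (1 + a) ^ 2 * (1 - (1 / 2 - a) ^ 2 - c ^ 2))⁻¹ •
    ((3 * c * (-14 + 20 * a - 6 * a ^ 2)) • x
      + (3 * (-3 + 4 * c ^ 2 + 20 * a - 4 * a * c ^ 2 - 15 * a ^ 2 + 2 * a ^ 3)) • y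
      + (36 * (1 - a)) • cross x y)

section Inverse

variable {n : ℕ} {cross : E n → E n → E n}

theorem formulaX_eq {p w : E n} {a c : ℝ} (hp : ‖p‖ ^ 2 = a) (hpw : inner ℝ p w = c) :
    formulaX cross p w =
      (((3 - 2 * a) * (1 + a) ^ 2 - 4 * (1 - a) * c ^ 2) / (3 * (1 + a) ^ 2)) • p
      + (-(2 * (3 + 8 * a + a ^ 2 - 4 * c ^ 2) * c) / (3 * (1 + a) ^ 2)) • w
      + (-(8 * a * c) / (3 * (1 + a) ^ 2)) • cross p w := by
  have h4 : ‖p‖ ^ 4 = a ^ 2 := by rw [← hp]; ring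
  rw [formulaX, real_inner_comm p w, hpw, h4, hp]
  module

theorem formulaY_eq {p w : E n} {a c : ℝ} (hp : ‖p‖ ^ 2 = a) (hpw : inner ℝ p w = c) :
    formulaY cross p w =
      (2 * (1 - a) * (1 + 3 * a) * c / (3 * (1 + a) ^ 2)) • p
      + ((-(1 + 2 * a) * (1 - 6 * a + a ^ 2) - 4 * (1 + 3 * a) * c ^ 2) / (3 * (1 + a) ^ 2)) • w
      + (-(4 * (1 + 2 * a) * (1 - a)) / (3 * (1 + a) ^ 2)) • cross p w := by
  have h4 : ‖p‖ ^ 4 = a ^ 2 := by rw [← hp]; ring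
  rw [formulaY, real_inner_comm p w, hpw, h4, hp]
  module

theorem inverseP_eq (a c : ℝ) (x y : E n) : inverseP cross a c x y =
      (3 * (1 - 28 * c ^ 2 + 4 * a + 12 * a * c ^ 2 + 5 * a ^ 2 + 2 * a ^ 3) /
        (4 * (1 + a) ^ 2 * (1 - (1 / 2 - a) ^ 2 - c ^ 2))) • x
      + (3 * c * (-6 + 8 * c ^ 2 + 32 * a - 2 * a ^ 2) /
        (4 * (1 + a) ^ 2 * (1 - (1 / 2 - a) ^ 2 - c ^ 2))) • y
      + (72 * c / (4 * (1 + a) ^ 2 * (1 - (1 / 2 - a) ^ 2 - c ^ 2))) • cross x y := by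
  rw [inverseP]
  simp only [smul_add, smul_smul, div_eq_inv_mul]

theorem inverseW_eq (a c : ℝ) (x y : E n) : inverseW cross a c x y =
      (3 * c * (-14 + 20 * a - 6 * a ^ 2) /
        (4 * (1 + a) ^ 2 * (1 - (1 / 2 - a) ^ 2 - c ^ 2))) • x
      + (3 * (-3 + 4 * c ^ 2 + 20 * a - 4 * a * c ^ 2 - 15 * a ^ 2 + 2 * a ^ 3) /
        (4 * (1 + a) ^ 2 * (1 - (1 / 2 - a) ^ 2 - c ^ 2))) • y
      + (36 * (1 - a) / (4 * (1 + a) ^ 2 * (1 - (1 / 2 - a) ^ 2 - c ^ 2))) • cross x y := by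
  rw [inverseW]
  simp only [smul_add, smul_smul, div_eq_inv_mul]

/-- Only coefficients are compared, never linear independence, so the identities derived this way
also hold where the two vectors are parallel. -/
theorem linearCombination_congr {u v z : E n} {α β γ δ ε ζ : ℝ} (h₁ : α = δ) (h₂ : β = ε)
    (h₃ : γ = ζ) : α • u + β • v + γ • z = δ • u + ε • v + ζ • z := by
  rw [h₁, h₂, h₃]

theorem combination_combination (u v z : E n) (α β γ a₁ b₁ c₁ a₂ b₂ c₂ a₃ b₃ c₃ : ℝ) :
    α • (a₁ • u + b₁ • v + c₁ • z) + β • (a₂ • u + b₂ • v + c₂ • z)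
        + γ • (a₃ • u + b₃ • v + c₃ • z) =
      (α * a₁ + β * a₂ + γ * a₃) • u + (α * b₁ + β * b₂ + γ * b₃) • v
        + (α * c₁ + β * c₂ + γ * c₃) • z := by
  module

theorem eq_fst_combination (u v z : E n) : u = (1 : ℝ) • u + (0 : ℝ) • v + (0 : ℝ) • z := by
  module

theorem eq_snd_combination (u v z : E n) : v = (0 : ℝ) • u + (1 : ℝ) • v + (0 : ℝ) • z := by
  module

/-! ### From `(p, w)` to `(x, y)` and back -/

section Forward

variable (h : IsVectorProduct cross) {p w : E n} {a c : ℝ} (hp : ‖p‖ ^ 2 = a)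
  (hw : ‖w‖ ^ 2 = 1 - a) (hpw : inner ℝ p w = c)

include h hp hw hpw

theorem inner_formulaX_self (ha : 1 + a ≠ 0) :
    inner ℝ (formulaX cross p w) (formulaX cross p w) = normSqX a c := by
  rw [formulaX_eq hp hpw, h.inner_combination, real_inner_self_eq_norm_sq,
    real_inner_self_eq_norm_sq, hp, hw, hpw, normSqX]
  field_simp
  ring

theorem inner_formulaY_self (ha : 1 + a ≠ 0) :
    inner ℝ (formulaY cross p w) (formulaY cross p w) = normSqY a c := by
  rw [formulaY_eq hp hpw, h.inner_combination, real_inner_self_eq_norm_sq,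
    real_inner_self_eq_norm_sq, hp, hw, hpw, normSqY]
  field_simp
  ring

theorem inner_formulaX_formulaY (ha : 1 + a ≠ 0) :
    inner ℝ (formulaX cross p w) (formulaY cross p w) = innerXY a c := by
  rw [formulaX_eq hp hpw, formulaY_eq hp hpw, h.inner_combination, real_inner_self_eq_norm_sq,
    real_inner_self_eq_norm_sq, hp, hw, hpw, innerXY]
  field_simp
  ring

/-- The third row of the transition matrix; the rows for `x` and `y` are the formula itself. -/
theorem cross_formula (ha : 1 + a ≠ 0) :
    cross (formulaX cross p w) (formulaY cross p w) =
      ((12 * c - 16 * c ^ 3 + 4 * a * c + 16 * a * c ^ 3 - 32 * a ^ 2 * c + 16 * a ^ 3 * c) /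
        (9 * (1 + a) ^ 2)) • p
      + ((-24 * c ^ 2 + 32 * c ^ 4 + 12 * a - 48 * a * c ^ 2 + 4 * a ^ 2 + 48 * a ^ 2 * c ^ 2
        - 32 * a ^ 3 + 16 * a ^ 4) / (9 * (1 + a) ^ 2)) • w
      + ((-3 + 4 * c ^ 2 + 14 * a - 24 * a * c ^ 2 + 25 * a ^ 2 + 4 * a ^ 2 * c ^ 2 - 28 * a ^ 3
        + 4 * a ^ 4) / (9 * (1 + a) ^ 2)) • cross p w := by
  rw [formulaX_eq hp hpw, formulaY_eq hp hpw, h.cross_combination, real_inner_self_eq_norm_sq,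
    real_inner_self_eq_norm_sq, hp, hw, hpw]
  apply linearCombination_congr <;> · field_simp; ring

theorem inverseP_formula (ha : 1 + a ≠ 0) (hr : 1 - (1 / 2 - a) ^ 2 - c ^ 2 ≠ 0) :
    inverseP cross a c (formulaX cross p w) (formulaY cross p w) = p := by
  rw [inverseP_eq, cross_formula h hp hw hpw ha, formulaX_eq hp hpw, formulaY_eq hp hpw,
    combination_combination]
  conv_rhs => rw [eq_fst_combination p w (cross p w)]
  -- The factor `1 - |z₀|²` is kept as an atom while denominators are cleared, and expanded only for
  -- the final polynomial identity.
  obtain ⟨r, hr'⟩ : ∃ r, r = 1 - (1 / 2 - a) ^ 2 - c ^ 2 := ⟨_, rfl⟩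
  apply linearCombination_congr
  all_goals
    rw [← hr'] at hr ⊢
    field_simp
    rw [hr']
    ring

theorem inverseW_formula (ha : 1 + a ≠ 0) (hr : 1 - (1 / 2 - a) ^ 2 - c ^ 2 ≠ 0) :
    inverseW cross a c (formulaX cross p w) (formulaY cross p w) = w := by
  rw [inverseW_eq, cross_formula h hp hw hpw ha, formulaX_eq hp hpw, formulaY_eq hp hpw,
    combination_combination]
  conv_rhs => rw [eq_snd_combination p w (cross p w)]
  obtain ⟨r, hr'⟩ : ∃ r, r = 1 - (1 / 2 - a) ^ 2 - c ^ 2 := ⟨_, rfl⟩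
  apply linearCombination_congr
  all_goals
    rw [← hr'] at hr ⊢
    field_simp
    rw [hr']
    ring

end Forward

/-! ### From `(x, y)` to `(p, w)` and back -/

section Backward

variable (h : IsVectorProduct cross) {x y : E n} {a c : ℝ}
  (hx : inner ℝ x x = normSqX a c) (hy : inner ℝ y y = normSqY a c)
  (hxy : inner ℝ x y = innerXY a c) (ha : 1 + a ≠ 0) (hr : 1 - (1 / 2 - a) ^ 2 - c ^ 2 ≠ 0)

include h hx hy hxy ha hr

/-- The vectors `x, y` enter only through their Gram matrix, which the sphere equations express in
`a, c`. -/
theorem norm_inverseP_sq : ‖inverseP cross a c x y‖ ^ 2 = a := by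
  rw [← real_inner_self_eq_norm_sq, inverseP_eq, h.inner_combination, hx, hy, hxy, normSqX,
    normSqY, innerXY]
  obtain ⟨r, hr'⟩ : ∃ r, r = 1 - (1 / 2 - a) ^ 2 - c ^ 2 := ⟨_, rfl⟩
  rw [← hr'] at hr ⊢
  field_simp
  rw [hr']
  ring

theorem norm_inverseW_sq : ‖inverseW cross a c x y‖ ^ 2 = 1 - a := by
  rw [← real_inner_self_eq_norm_sq, inverseW_eq, h.inner_combination, hx, hy, hxy, normSqX,
    normSqY, innerXY]
  obtain ⟨r, hr'⟩ : ∃ r, r = 1 - (1 / 2 - a) ^ 2 - c ^ 2 := ⟨_, rfl⟩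
  rw [← hr'] at hr ⊢
  field_simp
  rw [hr']
  ring

theorem inner_inverseP_inverseW :
    inner ℝ (inverseP cross a c x y) (inverseW cross a c x y) = c := by
  rw [inverseP_eq, inverseW_eq, h.inner_combination, hx, hy, hxy, normSqX, normSqY, innerXY]
  obtain ⟨r, hr'⟩ : ∃ r, r = 1 - (1 / 2 - a) ^ 2 - c ^ 2 := ⟨_, rfl⟩
  rw [← hr'] at hr ⊢
  field_simp
  rw [hr']
  ring

theorem cross_inverse : cross (inverseP cross a c x y) (inverseW cross a c x y) =
      (3 * c * (4 - 20 * a + 16 * a ^ 2) /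
        (4 * (1 + a) ^ 2 * (1 - (1 / 2 - a) ^ 2 - c ^ 2))) • x
      + (3 * a * (-12 + 8 * c ^ 2 + 20 * a - 8 * a ^ 2) /
        (4 * (1 + a) ^ 2 * (1 - (1 / 2 - a) ^ 2 - c ^ 2))) • y
      + (9 * (-1 + 6 * a - a ^ 2) /
        (4 * (1 + a) ^ 2 * (1 - (1 / 2 - a) ^ 2 - c ^ 2))) • cross x y := by
  rw [inverseP_eq, inverseW_eq, h.cross_combination, hx, hy, hxy, normSqX, normSqY, innerXY]
  obtain ⟨r, hr'⟩ : ∃ r, r = 1 - (1 / 2 - a) ^ 2 - c ^ 2 := ⟨_, rfl⟩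
  apply linearCombination_congr
  all_goals
    rw [← hr'] at hr ⊢
    field_simp
    rw [hr']
    ring

theorem formulaX_inverse :
    formulaX cross (inverseP cross a c x y) (inverseW cross a c x y) = x := by
  rw [formulaX_eq (norm_inverseP_sq h hx hy hxy ha hr) (inner_inverseP_inverseW h hx hy hxy ha hr),
    cross_inverse h hx hy hxy ha hr, inverseP_eq, inverseW_eq, combination_combination]
  conv_rhs => rw [eq_fst_combination x y (cross x y)]
  obtain ⟨r, hr'⟩ : ∃ r, r = 1 - (1 / 2 - a) ^ 2 - c ^ 2 := ⟨_, rfl⟩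
  apply linearCombination_congr
  all_goals
    rw [← hr'] at hr ⊢
    field_simp
    rw [hr']
    ring

theorem formulaY_inverse :
    formulaY cross (inverseP cross a c x y) (inverseW cross a c x y) = y := by
  rw [formulaY_eq (norm_inverseP_sq h hx hy hxy ha hr) (inner_inverseP_inverseW h hx hy hxy ha hr),
    cross_inverse h hx hy hxy ha hr, inverseP_eq, inverseW_eq, combination_combination]
  conv_rhs => rw [eq_snd_combination x y (cross x y)]
  obtain ⟨r, hr'⟩ : ∃ r, r = 1 - (1 / 2 - a) ^ 2 - c ^ 2 := ⟨_, rfl⟩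
  apply linearCombination_congr
  all_goals
    rw [← hr'] at hr ⊢
    field_simp
    rw [hr']
    ring

end Backward

end Inverse

/-! ### The equations of the Brieskorn sphere -/

section Complex

variable {n : ℕ}

@[simp] theorem reVec_complexVec (x y : E n) : reVec (complexVec x y) = x := rfl

@[simp] theorem imVec_complexVec (x y : E n) : imVec (complexVec x y) = y := rfl

theorem complexVec_reVec_imVec (z : EuclideanSpace ℂ (Fin n)) :
    complexVec (reVec z) (imVec z) = z := rfl

theorem sum_sq_eq (z : EuclideanSpace ℂ (Fin n)) :
    ∑ i, z i ^ 2 = (⟨inner ℝ (reVec z) (reVec z) - inner ℝ (imVec z) (imVec z),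
      2 * inner ℝ (reVec z) (imVec z)⟩ : ℂ) := by
  apply Complex.ext
  · simp only [PiLp.inner_apply, reVec, imVec, pow_two, Complex.re_sum, Complex.mul_re,
      RCLike.inner_apply, RCLike.conj_to_real, Finset.sum_sub_distrib]
  · simp only [PiLp.inner_apply, reVec, imVec, pow_two, Complex.im_sum, Complex.mul_im,
      Finset.mul_sum, RCLike.inner_apply, RCLike.conj_to_real]
    exact Finset.sum_congr rfl fun i _ => by ring

theorem sum_norm_sq_eq (z : EuclideanSpace ℂ (Fin n)) :
    ∑ i, ‖z i‖ ^ 2 = inner ℝ (reVec z) (reVec z) + inner ℝ (imVec z) (imVec z) := by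
  simp only [PiLp.inner_apply, reVec, imVec, Complex.sq_norm, Complex.normSq_apply,
    Finset.sum_add_distrib, RCLike.inner_apply, RCLike.conj_to_real]

/-- The equations of the Brieskorn sphere, solved for the Gram matrix of `x` and `y`. -/
theorem mem_brieskornSphere_iff (z : ℂ × EuclideanSpace ℂ (Fin n)) :
    z ∈ brieskornSphere n ↔
      inner ℝ (reVec z.2) (reVec z.2) = normSqX (1 / 2 - z.1.re) (-z.1.im) ∧
      inner ℝ (imVec z.2) (imVec z.2) = normSqY (1 / 2 - z.1.re) (-z.1.im) ∧
      inner ℝ (reVec z.2) (imVec z.2) = innerXY (1 / 2 - z.1.re) (-z.1.im) := by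
  obtain ⟨⟨u, v⟩, z⟩ := z
  have hcube : (8 / 9 : ℂ) * (⟨u, v⟩ : ℂ) ^ 3 =
      ⟨8 / 9 * (u ^ 3 - 3 * u * v ^ 2), 8 / 9 * (3 * u ^ 2 * v - v ^ 3)⟩ := by
    have h89 : (8 / 9 : ℂ) = ((8 / 9 : ℝ) : ℂ) := by norm_num
    rw [h89]
    apply Complex.ext
    · rw [Complex.re_ofReal_mul]
      simp only [pow_succ, pow_zero, one_mul, Complex.mul_re, Complex.mul_im]
      ring
    · rw [Complex.im_ofReal_mul]
      simp only [pow_succ, pow_zero, one_mul, Complex.mul_re, Complex.mul_im]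
      ring
  simp only [brieskornSphere, Set.mem_ofPred_eq]
  rw [sum_sq_eq, sum_norm_sq_eq, hcube, Complex.sq_norm, Complex.normSq_mk, Complex.ext_iff]
  simp only [Complex.add_re, Complex.add_im, Complex.zero_re, Complex.zero_im, normSqX, normSqY,
    innerXY]
  constructor
  · rintro ⟨⟨h₁, h₂⟩, h₃⟩
    refine ⟨?_, ?_, ?_⟩ <;> linarith
  · rintro ⟨h₁, h₂, h₃⟩
    refine ⟨⟨?_, ?_⟩, ?_⟩ <;> linarith

/-- On the Brieskorn sphere, `|z₀| ≤ 1/2`. -/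
theorem norm_fst_sq_le {z : ℂ × EuclideanSpace ℂ (Fin n)} (hz : z ∈ brieskornSphere n) :
    z.1.re ^ 2 + z.1.im ^ 2 ≤ 1 / 4 := by
  -- This cruder bound, from the norm equation alone, ensures `1 - s > 0` when the square is
  -- cancelled below.
  have h₃ : z.1.re ^ 2 + z.1.im ^ 2 ≤ 1 / 3 := by
    have h := hz.2
    have hnn : 0 ≤ ∑ i, ‖z.2 i‖ ^ 2 := by positivity
    rw [Complex.sq_norm, Complex.normSq_apply] at h
    linarith
  obtain ⟨hx, hy, hxy⟩ := (mem_brieskornSphere_iff z).1 hz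
  have hcs := real_inner_mul_inner_self_le (reVec z.2) (imVec z.2)
  rw [hx, hy, hxy, normSqX, normSqY, innerXY] at hcs
  obtain ⟨s, hs⟩ : ∃ s, s = z.1.re ^ 2 + z.1.im ^ 2 := ⟨_, rfl⟩
  -- The Gram determinant of `(x, y)` equals `(4/81)(1 - 4s)(1 - s)²`.
  have hprod : 0 ≤ (1 - 4 * s) * (1 - s) ^ 2 := by
    rw [hs]
    linarith
  rw [← hs] at h₃ ⊢
  have := nonneg_of_mul_nonneg_left hprod (by nlinarith)
  linarith

end Complex

/-! ### Smoothness of the map and its inverse -/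

section Smoothness

variable {n : ℕ} {V : Type*} [NormedAddCommGroup V] [NormedSpace ℝ V] {s : Set V}

theorem contDiffOn_complex_mk {u v : V → ℝ} (hu : ContDiffOn ℝ ∞ u s) (hv : ContDiffOn ℝ ∞ v s) :
    ContDiffOn ℝ ∞ (fun q => (⟨u q, v q⟩ : ℂ)) s :=
  Complex.equivRealProdCLM.symm.contDiff.comp_contDiffOn (hu.prodMk hv)

theorem contDiffOn_complexVec {x y : V → E n} (hx : ContDiffOn ℝ ∞ x s)
    (hy : ContDiffOn ℝ ∞ y s) : ContDiffOn ℝ ∞ (fun q => complexVec (x q) (y q)) s := by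
  rw [contDiffOn_piLp]
  intro i
  exact contDiffOn_complex_mk ((contDiffOn_piLp 2).1 hx i) ((contDiffOn_piLp 2).1 hy i)

theorem contDiff_reVec : ContDiff ℝ ∞ (reVec : EuclideanSpace ℂ (Fin n) → E n) := by
  rw [contDiff_piLp]
  intro i
  exact Complex.reCLM.contDiff.comp ((contDiff_piLp 2).1 contDiff_id i)

theorem contDiff_imVec : ContDiff ℝ ∞ (imVec : EuclideanSpace ℂ (Fin n) → E n) := by
  rw [contDiff_piLp]
  intro i
  exact Complex.imCLM.contDiff.comp ((contDiff_piLp 2).1 contDiff_id i)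

variable {cross : E n → E n → E n} (h : IsVectorProduct cross)
include h

theorem contDiff_brieskornMap : ContDiff ℝ ∞ (brieskornMap cross) := by
  have hcross := h.contDiff
  have hp : ContDiff ℝ ∞ fun q : E n × E n => ‖q.1‖ ^ 2 := contDiff_fst.norm_sq ℝ
  have hw : ContDiff ℝ ∞ fun q : E n × E n => ‖q.2‖ ^ 2 := contDiff_snd.norm_sq ℝ
  have hp4 : ContDiff ℝ ∞ fun q : E n × E n => ‖q.1‖ ^ 4 := by
    have : (fun q : E n × E n => ‖q.1‖ ^ 4) = fun q => (‖q.1‖ ^ 2) ^ 2 := by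
      ext q
      ring
    rw [this]
    exact hp.pow 2
  have hpw : ContDiff ℝ ∞ fun q : E n × E n => inner ℝ q.1 q.2 := contDiff_fst.inner ℝ contDiff_snd
  have hwp : ContDiff ℝ ∞ fun q : E n × E n => inner ℝ q.2 q.1 := contDiff_snd.inner ℝ contDiff_fst
  have hk : ContDiff ℝ ∞ fun q : E n × E n => 1 / (3 * (1 + ‖q.1‖ ^ 2) ^ 2) :=
    contDiff_const.div (contDiff_const.mul ((contDiff_const.add hp).pow 2)) fun q => by positivity
  rw [← contDiffOn_univ]
  refine (contDiffOn_complex_mk ?_ ?_).prodMk (contDiffOn_complexVec ?_ ?_) <;>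
    rw [contDiffOn_univ]
  · fun_prop
  · fun_prop
  · exact hk.smul (by fun_prop)
  · exact hk.smul (by fun_prop)

section Inverse

variable {a c : V → ℝ} {x y : V → E n} (ha : ContDiff ℝ ∞ a) (hc : ContDiff ℝ ∞ c)
  (hx : ContDiff ℝ ∞ x) (hy : ContDiff ℝ ∞ y) (ha₀ : ∀ z ∈ s, 1 + a z ≠ 0)
  (hr₀ : ∀ z ∈ s, 1 - (1 / 2 - a z) ^ 2 - c z ^ 2 ≠ 0)
include ha hc hx hy ha₀ hr₀

theorem contDiffOn_inverseP :
    ContDiffOn ℝ ∞ (fun z => inverseP cross (a z) (c z) (x z) (y z)) s := by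
  have hcross : ContDiff ℝ ∞ fun z => cross (x z) (y z) := h.contDiff.comp (hx.prodMk hy)
  -- The product is hidden behind an opaque function of `z`, so that `fun_prop` uses its smoothness
  -- as a hypothesis.
  obtain ⟨u, hu⟩ : ∃ u : V → E n, ∀ z, cross (x z) (y z) = u z := ⟨_, fun _ => rfl⟩
  simp only [inverseP, hu] at hcross ⊢
  apply ContDiffOn.fun_smul
  · apply ContDiffOn.inv
    · apply ContDiff.contDiffOn
      fun_prop
    · exact fun z hz =>
        mul_ne_zero (mul_ne_zero four_ne_zero (pow_ne_zero 2 (ha₀ z hz))) (hr₀ z hz)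
  · apply ContDiff.contDiffOn
    fun_prop

theorem contDiffOn_inverseW :
    ContDiffOn ℝ ∞ (fun z => inverseW cross (a z) (c z) (x z) (y z)) s := by
  have hcross : ContDiff ℝ ∞ fun z => cross (x z) (y z) := h.contDiff.comp (hx.prodMk hy)
  obtain ⟨u, hu⟩ : ∃ u : V → E n, ∀ z, cross (x z) (y z) = u z := ⟨_, fun _ => rfl⟩
  simp only [inverseW, hu] at hcross ⊢
  apply ContDiffOn.fun_smul
  · apply ContDiffOn.inv
    · apply ContDiff.contDiffOn
      fun_prop
    · exact fun z hz =>
        mul_ne_zero (mul_ne_zero four_ne_zero (pow_ne_zero 2 (ha₀ z hz))) (hr₀ z hz)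
  · apply ContDiff.contDiffOn
    fun_prop

end Inverse

end Smoothness

/-! ### The equivariant diffeomorphism for a general vector product -/

section Diffeomorphism

variable {n : ℕ} {cross : E n → E n → E n}

/-- The inverse of the formula. -/
noncomputable def brieskornInverse (cross : E n → E n → E n)
    (z : ℂ × EuclideanSpace ℂ (Fin n)) : E n × E n :=
  (inverseP cross (1 / 2 - z.1.re) (-z.1.im) (reVec z.2) (imVec z.2),
    inverseW cross (1 / 2 - z.1.re) (-z.1.im) (reVec z.2) (imVec z.2))

/-- An open neighbourhood of the Brieskorn sphere on which the inverse is smooth. -/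
def inverseDomain (n : ℕ) : Set (ℂ × EuclideanSpace ℂ (Fin n)) :=
  {z | 1 + (1 / 2 - z.1.re) ≠ 0 ∧ 1 - (1 / 2 - (1 / 2 - z.1.re)) ^ 2 - (-z.1.im) ^ 2 ≠ 0}

theorem isOpen_inverseDomain : IsOpen (inverseDomain n) :=
  (isOpen_ne_fun (by fun_prop) (by fun_prop)).inter (isOpen_ne_fun (by fun_prop) (by fun_prop))

/-- From `|z₀| ≤ 1/2` the two quantities are at least `1` and `3/4`. -/
theorem brieskornSphere_subset_inverseDomain : brieskornSphere n ⊆ inverseDomain n := by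
  intro z hz
  have := norm_fst_sq_le hz
  constructor <;> nlinarith

theorem contDiffOn_brieskornInverse (h : IsVectorProduct cross) :
    ContDiffOn ℝ ∞ (brieskornInverse cross) (inverseDomain n) := by
  have hre : ContDiff ℝ ∞ fun z : ℂ × EuclideanSpace ℂ (Fin n) => z.1.re :=
    Complex.reCLM.contDiff.comp contDiff_fst
  have him : ContDiff ℝ ∞ fun z : ℂ × EuclideanSpace ℂ (Fin n) => z.1.im :=
    Complex.imCLM.contDiff.comp contDiff_fst
  have hx : ContDiff ℝ ∞ fun z : ℂ × EuclideanSpace ℂ (Fin n) => reVec z.2 :=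
    contDiff_reVec.comp contDiff_snd
  have hy : ContDiff ℝ ∞ fun z : ℂ × EuclideanSpace ℂ (Fin n) => imVec z.2 :=
    contDiff_imVec.comp contDiff_snd
  have ha : ContDiff ℝ ∞ fun z : ℂ × EuclideanSpace ℂ (Fin n) => 1 / 2 - z.1.re :=
    contDiff_const.sub hre
  exact (contDiffOn_inverseP h ha him.neg hx hy (fun _ hz => hz.1) fun _ hz => hz.2).prodMk
    (contDiffOn_inverseW h ha him.neg hx hy (fun _ hz => hz.1) fun _ hz => hz.2)

theorem unitSphere_spec {q : E n × E n} (hq : q ∈ unitSphere n) :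
    1 / 2 - (brieskornMap cross q).1.re = ‖q.1‖ ^ 2 ∧
      -(brieskornMap cross q).1.im = inner ℝ q.1 q.2 ∧ ‖q.2‖ ^ 2 = 1 - ‖q.1‖ ^ 2 := by
  have hq' : ‖q.1‖ ^ 2 + ‖q.2‖ ^ 2 = 1 := hq
  refine ⟨?_, neg_neg _, by linarith⟩
  change 1 / 2 - 1 / 2 * (‖q.2‖ ^ 2 - ‖q.1‖ ^ 2) = ‖q.1‖ ^ 2
  linarith

theorem mapsTo_brieskornMap (h : IsVectorProduct cross) :
    Set.MapsTo (brieskornMap cross) (unitSphere n) (brieskornSphere n) := by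
  intro q hq
  obtain ⟨h₁, h₂, h₃⟩ := unitSphere_spec (cross := cross) hq
  have ha : 1 + ‖q.1‖ ^ 2 ≠ 0 := by positivity
  rw [mem_brieskornSphere_iff, h₁, h₂]
  exact ⟨inner_formulaX_self h rfl h₃ rfl ha, inner_formulaY_self h rfl h₃ rfl ha,
    inner_formulaX_formulaY h rfl h₃ rfl ha⟩

theorem mapsTo_brieskornInverse (h : IsVectorProduct cross) :
    Set.MapsTo (brieskornInverse cross) (brieskornSphere n) (unitSphere n) := by
  intro z hz
  obtain ⟨ha, hr⟩ := brieskornSphere_subset_inverseDomain hz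
  obtain ⟨hx, hy, hxy⟩ := (mem_brieskornSphere_iff z).1 hz
  change ‖inverseP cross _ _ _ _‖ ^ 2 + ‖inverseW cross _ _ _ _‖ ^ 2 = 1
  rw [norm_inverseP_sq h hx hy hxy ha hr, norm_inverseW_sq h hx hy hxy ha hr]
  ring

theorem leftInvOn_brieskornInverse (h : IsVectorProduct cross) :
    Set.LeftInvOn (brieskornInverse cross) (brieskornMap cross) (unitSphere n) := by
  intro q hq
  -- The denominators are nonzero because the image point already lies on the Brieskorn sphere.
  obtain ⟨ha, hr⟩ := brieskornSphere_subset_inverseDomain (mapsTo_brieskornMap h hq)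
  obtain ⟨h₁, h₂, h₃⟩ := unitSphere_spec (cross := cross) hq
  rw [h₁] at ha
  rw [h₁, h₂] at hr
  rw [brieskornInverse, h₁, h₂]
  exact Prod.ext (inverseP_formula h rfl h₃ rfl ha hr) (inverseW_formula h rfl h₃ rfl ha hr)

theorem rightInvOn_brieskornInverse (h : IsVectorProduct cross) :
    Set.RightInvOn (brieskornInverse cross) (brieskornMap cross) (brieskornSphere n) := by
  intro z hz
  obtain ⟨ha, hr⟩ := brieskornSphere_subset_inverseDomain hz
  obtain ⟨hx, hy, hxy⟩ := (mem_brieskornSphere_iff z).1 hz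
  rw [brieskornMap, brieskornInverse, formulaX_inverse h hx hy hxy ha hr,
    formulaY_inverse h hx hy hxy ha hr, norm_inverseP_sq h hx hy hxy ha hr,
    norm_inverseW_sq h hx hy hxy ha hr, inner_inverseP_inverseW h hx hy hxy ha hr]
  refine Prod.ext (Complex.ext ?_ (neg_neg _)) (complexVec_reVec_imVec _)
  change 1 / 2 * (1 - (1 / 2 - z.1.re) - (1 / 2 - z.1.re)) = z.1.re
  ring

theorem isDiffeomorphismOnto_brieskornMap (h : IsVectorProduct cross) :
    IsDiffeomorphismOnto (brieskornMap cross) (unitSphere n) (brieskornSphere n) :=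
  ⟨mapsTo_brieskornMap h,
    fun _ _ => ⟨Set.univ, _, isOpen_univ, Set.mem_univ _, (contDiff_brieskornMap h).contDiffOn,
      fun _ _ => rfl⟩,
    brieskornInverse cross, mapsTo_brieskornInverse h,
    ⟨leftInvOn_brieskornInverse h, rightInvOn_brieskornInverse h⟩,
    fun _ hz => ⟨inverseDomain n, _, isOpen_inverseDomain,
      brieskornSphere_subset_inverseDomain hz, contDiffOn_brieskornInverse h, fun _ _ => rfl⟩⟩

/-- A linear action by isometries that preserve the product makes the map equivariant. -/
theorem isEquivariantDiffeomorphism_brieskornMap {G : Type*} [Group G]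
    {ρ : Representation ℝ G (E n)} (h : IsVectorProduct cross)
    (hinner : ∀ g v w, inner ℝ (ρ g v) (ρ g w) = inner ℝ v w)
    (hcross : ∀ g v w, cross (ρ g v) (ρ g w) = ρ g (cross v w)) :
    IsEquivariantDiffeomorphism ρ (brieskornMap cross) := by
  have hnorm : ∀ g v, ‖ρ g v‖ = ‖v‖ := fun g v => by
    rw [norm_eq_sqrt_real_inner, hinner, ← norm_eq_sqrt_real_inner]
  refine ⟨isDiffeomorphismOnto_brieskornMap h, fun g => ⟨fun q hq => ?_, fun z hz => ?_,
    fun q _ => ?_⟩⟩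
  · change ‖ρ g q.1‖ ^ 2 + ‖ρ g q.2‖ ^ 2 = 1
    rw [hnorm, hnorm]
    exact hq
  · rw [mem_brieskornSphere_iff] at hz ⊢
    simpa only [complexAction, reVec_complexVec, imVec_complexVec, hinner] using hz
  · simp only [brieskornMap, diagAction, complexAction, reVec_complexVec, imVec_complexVec, hnorm,
      hinner, formulaX, formulaY, hcross, map_smul, map_add, map_sub]

end Diffeomorphism

/-! ### The cross product of `ℝ³` and `SO(3)` -/

section DimensionThree

theorem cross3_apply (p w : E 3) : cross3 p w =
    !₂[p 1 * w 2 - p 2 * w 1, p 2 * w 0 - p 0 * w 2, p 0 * w 1 - p 1 * w 0] := rfl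

theorem inner_three (v w : E 3) : inner ℝ v w = v 0 * w 0 + v 1 * w 1 + v 2 * w 2 := by
  simp only [PiLp.inner_apply, Fin.sum_univ_three, RCLike.inner_apply, RCLike.conj_to_real]
  ring

theorem isVectorProduct_cross3 : IsVectorProduct cross3 where
  contDiff := by
    rw [contDiff_piLp]
    intro i
    fin_cases i <;> simp [cross3_apply] <;> fun_prop
  add_left x y z := by
    ext i
    fin_cases i <;> simp [cross3_apply] <;> ring
  smul_left r x y := by
    ext i
    fin_cases i <;> simp [cross3_apply] <;> ring
  anticomm x y := by
    ext i
    fin_cases i <;> simp [cross3_apply] <;> ring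
  cross_cross x y := by
    ext i
    rw [inner_three, inner_three]
    fin_cases i <;> simp [cross3_apply] <;> ring
  inner_left x y := by
    simp only [inner_three, cross3_apply]
    simp
    ring
  inner_self x y := by
    simp only [inner_three, cross3_apply]
    simp
    ring

theorem inner_so3Rep (A : Matrix.specialOrthogonalGroup (Fin 3) ℝ) (v w : E 3) :
    inner ℝ (so3Rep A v) (so3Rep A w) = inner ℝ v w := by
  have hA : (A : Matrix (Fin 3) (Fin 3) ℝ).transpose * A = 1 :=
    (Matrix.mem_orthogonalGroup_iff' _ _).1 (Matrix.mem_specialOrthogonalGroup_iff.1 A.2).1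
  change inner ℝ (WithLp.toLp 2 ((A : Matrix (Fin 3) (Fin 3) ℝ).mulVec v.ofLp))
    (WithLp.toLp 2 ((A : Matrix (Fin 3) (Fin 3) ℝ).mulVec w.ofLp)) = _
  rw [EuclideanSpace.inner_eq_star_dotProduct, EuclideanSpace.inner_eq_star_dotProduct]
  simp only [star_trivial]
  rw [Matrix.dotProduct_mulVec, ← Matrix.mulVec_transpose, Matrix.mulVec_mulVec, hA,
    Matrix.one_mulVec]

/-- The cross product of two transformed vectors, in terms of the transposed matrix. -/
theorem transpose_mulVec_crossProduct (A : Matrix (Fin 3) (Fin 3) ℝ) (v w : Fin 3 → ℝ) :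
    A.transpose.mulVec (crossProduct (A.mulVec v) (A.mulVec w)) = A.det • crossProduct v w := by
  ext i
  fin_cases i <;>
    simp [cross_apply, Matrix.mulVec, dotProduct, Fin.sum_univ_succ, Matrix.det_fin_three] <;>
    ring

theorem cross3_so3Rep (A : Matrix.specialOrthogonalGroup (Fin 3) ℝ) (v w : E 3) :
    cross3 (so3Rep A v) (so3Rep A w) = so3Rep A (cross3 v w) := by
  obtain ⟨hO, hdet⟩ := Matrix.mem_specialOrthogonalGroup_iff.1 A.2
  have hA : (A : Matrix (Fin 3) (Fin 3) ℝ) * (A : Matrix (Fin 3) (Fin 3) ℝ).transpose = 1 :=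
    (Matrix.mem_orthogonalGroup_iff _ _).1 hO
  have h := transpose_mulVec_crossProduct (A : Matrix (Fin 3) (Fin 3) ℝ) v.ofLp w.ofLp
  rw [hdet, one_smul] at h
  -- Multiplying by `A` cancels the transpose.
  have h' := congrArg (A : Matrix (Fin 3) (Fin 3) ℝ).mulVec h
  rw [Matrix.mulVec_mulVec, hA, Matrix.one_mulVec] at h'
  exact congrArg (WithLp.toLp 2) h'

end DimensionThree

/-! ### The cross product of `ℝ⁷` and `G₂` -/

section DimensionSeven

namespace Octonion

@[simp] theorem fst_re_ofIm (v : E 7) : (ofIm v).fst.re = 0 := rfl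

@[simp] theorem fst_imI_ofIm (v : E 7) : (ofIm v).fst.imI = v 0 := rfl

@[simp] theorem fst_imJ_ofIm (v : E 7) : (ofIm v).fst.imJ = v 1 := rfl

@[simp] theorem fst_imK_ofIm (v : E 7) : (ofIm v).fst.imK = v 2 := rfl

@[simp] theorem snd_re_ofIm (v : E 7) : (ofIm v).snd.re = v 3 := rfl

@[simp] theorem snd_imI_ofIm (v : E 7) : (ofIm v).snd.imI = v 4 := rfl

@[simp] theorem snd_imJ_ofIm (v : E 7) : (ofIm v).snd.imJ = v 5 := rfl

@[simp] theorem snd_imK_ofIm (v : E 7) : (ofIm v).snd.imK = v 6 := rfl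

end Octonion

theorem cross7_apply (p w : E 7) : cross7 p w =
    Octonion.im (Octonion.ofIm p * Octonion.ofIm w) := rfl

/-- In coordinates the vector product axioms become polynomial identities. -/
theorem cross7_eq (p w : E 7) : cross7 p w =
    !₂[p 1 * w 2 - p 2 * w 1 - w 3 * p 4 + w 4 * p 3 + w 5 * p 6 - w 6 * p 5,
      -p 0 * w 2 + p 2 * w 0 - w 3 * p 5 - w 4 * p 6 + w 5 * p 3 + w 6 * p 4,
      p 0 * w 1 - p 1 * w 0 - w 3 * p 6 + w 4 * p 5 - w 5 * p 4 + w 6 * p 3,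
      -w 4 * p 0 - w 5 * p 1 - w 6 * p 2 + p 4 * w 0 + p 5 * w 1 + p 6 * w 2,
      w 3 * p 0 + w 5 * p 2 - w 6 * p 1 - p 3 * w 0 - p 5 * w 2 + p 6 * w 1,
      w 3 * p 1 - w 4 * p 2 + w 6 * p 0 - p 3 * w 1 + p 4 * w 2 - p 6 * w 0,
      w 3 * p 2 + w 4 * p 1 - w 5 * p 0 - p 3 * w 2 - p 4 * w 1 + p 5 * w 0] := by
  ext i
  fin_cases i <;> simp [cross7_apply, Octonion.im_apply] <;> ring

theorem inner_seven (v w : E 7) : inner ℝ v w = v 0 * w 0 + v 1 * w 1 + v 2 * w 2 + v 3 * w 3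
    + v 4 * w 4 + v 5 * w 5 + v 6 * w 6 := by
  simp only [PiLp.inner_apply, Fin.sum_univ_seven, RCLike.inner_apply, RCLike.conj_to_real]
  ring

theorem isVectorProduct_cross7 : IsVectorProduct cross7 where
  contDiff := by
    rw [contDiff_piLp]
    intro i
    fin_cases i <;> simp [cross7_eq] <;> fun_prop
  add_left x y z := by
    ext i
    fin_cases i <;> simp [cross7_eq] <;> ring
  smul_left r x y := by
    ext i
    fin_cases i <;> simp [cross7_eq] <;> ring
  anticomm x y := by
    ext i
    fin_cases i <;> simp [cross7_eq] <;> ring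
  cross_cross x y := by
    ext i
    rw [inner_seven, inner_seven]
    fin_cases i <;> simp [cross7_eq] <;> ring
  inner_left x y := by
    simp only [inner_seven, cross7_eq]
    simp
    ring
  inner_self x y := by
    simp only [inner_seven, cross7_eq]
    simp
    ring

/-- The product of two imaginary octonions. -/
theorem ofIm_mul_ofIm (v w : E 7) : Octonion.ofIm v * Octonion.ofIm w =
    Octonion.ofIm (cross7 v w) - inner ℝ v w • (1 : Octonion) := by
  have h0 : ((Octonion.ofIm v * Octonion.ofIm w) + inner ℝ v w • (1 : Octonion)).fst.re = 0 := by
    rw [inner_seven]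
    simp
    ring
  have h1 : Octonion.im (1 : Octonion) = 0 := by
    ext i
    fin_cases i <;> simp [Octonion.im_apply]
  have h := Octonion.ofIm_im h0
  rw [map_add, map_smul, h1, smul_zero, add_zero] at h
  rw [cross7_apply, h]
  module

theorem ofIm_g2Rep (φ : G2) (v : E 7) :
    Octonion.ofIm (g2Rep φ v) = φ.1 (Octonion.ofIm v) :=
  Octonion.ofIm_im (G2.map_im φ rfl)

/-- Apply `φ`, which fixes `1`, to `vw = v × w - ⟨v, w⟩1`. The real part then yields invariance of
the inner product, and the imaginary part that of the cross product. -/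
theorem ofIm_cross7_g2Rep (φ : G2) (v w : E 7) :
    Octonion.ofIm (cross7 (g2Rep φ v) (g2Rep φ w)) -
        inner ℝ (g2Rep φ v) (g2Rep φ w) • (1 : Octonion) =
      Octonion.ofIm (g2Rep φ (cross7 v w)) - inner ℝ v w • (1 : Octonion) := by
  rw [← ofIm_mul_ofIm, ofIm_g2Rep, ofIm_g2Rep, ofIm_g2Rep, ← φ.2, ofIm_mul_ofIm, map_sub, map_smul,
    G2.map_one]

theorem inner_g2Rep (φ : G2) (v w : E 7) :
    inner ℝ (g2Rep φ v) (g2Rep φ w) = inner ℝ v w := by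
  have h := congrArg (fun u : Octonion => u.fst.re) (ofIm_cross7_g2Rep φ v w)
  simpa using h

theorem cross7_g2Rep (φ : G2) (v w : E 7) :
    cross7 (g2Rep φ v) (g2Rep φ w) = g2Rep φ (cross7 v w) := by
  have h := ofIm_cross7_g2Rep φ v w
  rw [inner_g2Rep, sub_left_inj] at h
  simpa only [Octonion.im_ofIm] using congrArg Octonion.im h

end DimensionSeven

end BrieskornSpheres

theorem mainTheorem4 :
    BrieskornSpheres.IsEquivariantDiffeomorphism BrieskornSpheres.so3Rep
        (BrieskornSpheres.brieskornMap BrieskornSpheres.cross3) ∧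
      BrieskornSpheres.IsEquivariantDiffeomorphism BrieskornSpheres.g2Rep
        (BrieskornSpheres.brieskornMap BrieskornSpheres.cross7) :=
  ⟨BrieskornSpheres.isEquivariantDiffeomorphism_brieskornMap
      BrieskornSpheres.isVectorProduct_cross3 BrieskornSpheres.inner_so3Rep
      BrieskornSpheres.cross3_so3Rep,
    BrieskornSpheres.isEquivariantDiffeomorphism_brieskornMap
      BrieskornSpheres.isVectorProduct_cross7 BrieskornSpheres.inner_g2Rep
      BrieskornSpheres.cross7_g2Rep⟩
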